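/- Let $(\mathcal C,\mathbb E,\mathfrak s)$ be an extriangulated category in the sense of Nakaoka and Palu. An $\mathbb E$-triangle $X\xrightarrow{f}Y\xrightarrow{g}Z\overset{\delta}{\dashrightarrow}$ consists of $\delta\in\mathbb E(Z,X)$ and a sequence with $\mathfrak s(\delta)=[X\xrightarrow{f}Y\xrightarrow{g}Z]$; then $f$ is called an $\mathbb E$-inflation and $g$ an $\mathbb E$-deflation. A morphism from it to an $\mathbb E$-triangle $X'\xrightarrow{f'}Y'\xrightarrow{g'}Z'\overset{\delta'}{\dashrightarrow}$ is a triple $(\alpha,\beta,\gamma)$ with $\beta f=f'\alpha$, $\gamma g=g'\beta$ and $\alpha_*\delta=\gamma^*\delta'$. Such a morphism is called homotopic if there are an $\mathbb E$-triangle $X'\xrightarrow{k}M\xrightarrow{t}Z\overset{\eta}{\dashrightarrow}$ and morphisms $\beta_1:Y\to M$, $\beta_2:M\to Y'$ with $\beta=\beta_2\beta_1$ such that $(\alpha,\beta_1,1_Z)$ and $(1_{X'},\beta_2,\gamma)$ are morphisms of $\mathbb E$-triangles, from $(f,g,\delta)$ to $(k,t,\eta)$ and from $(k,t,\eta)$ to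 $(f',g',\delta')$ respectively, and $$X\xrightarrow{\binom{f}{\alpha}}Y\oplus X'\xrightarrow{(\beta_1,\,-k)}M\overset{t^*\delta}{\dashrightarrow},\qquad M\xrightarrow{\binom{-t}{\beta_2}}Z\oplus Y'\xrightarrow{(\gamma,\,g')}Z'\overset{k_*\delta'}{\dashrightarrow}$$ are $\mathbb E$-triangles. A morphism $f':A'\to B'$ is a retract of $f:A\to B$ if there are $i:A'\to A$, $p:A\to A'$, $j:B'\to B$, $q:B\to B'$ with $fi=jf'$, $f'p=qf$, $pi=1_{A'}$ and $qj=1_{B'}$. The category $\mathcal C$ is weakly idempotent complete if every section (split monomorphism) in $\mathcal C$ has a cokernel. Suppose given four $\mathbb E$-triangles $$A_1\xrightarrow{f_A}A_2\xrightarrow{g_A}A_3\overset{\delta_A}{\dashrightarrow},\quad B_1\xrightarrow{f_B}B_2\xrightarrow{g_B}B_3\overset{\delta_B}{\dashrightarrow},\quad A_2\xrightarrow{i_2}B_2\xrightarrow{p_2}C_2\overset{\varepsilon_2}{\dashrightarrow},\quad A_3\xrightarrow{i_3}B_3\xrightarrow{p_3}C_3\overset{\varepsilon_3}{\dashrightarrow}$$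 such that $g_Bi_2=i_3g_A$. Then there exist $i_1:A_1\to B_1$ and $g_C:C_2\to C_3$ such that (1) $i_1$ is a retract of some $\mathbb E$-inflation and $g_C$ is a retract of some $\mathbb E$-deflation; (2) $(i_1,i_2,i_3)$, from $(f_A,g_A,\delta_A)$ to $(f_B,g_B,\delta_B)$, and $(g_A,g_B,g_C)$, from $(i_2,p_2,\varepsilon_2)$ to $(i_3,p_3,\varepsilon_3)$, are homotopic morphisms of $\mathbb E$-triangles. Moreover, $\mathcal C$ is weakly idempotent complete if and only if all data of four $\mathbb E$-triangles as above with $g_Bi_2=i_3g_A$ can be completed to a $3\times3$ diagram, that is, there always exist $\mathbb E$-triangles $A_1\xrightarrow{i_1}B_1\xrightarrow{p_1}C_1\overset{\varepsilon_1}{\dashrightarrow}$ and $C_1\xrightarrow{f_C}C_2\xrightarrow{g_C}C_3\overset{\delta_C}{\dashrightarrow}$ such that $(i_1,i_2,i_3)$ and $(p_1,p_2,p_3)$ are morphisms between the $\mathbb E$-triangles $(f_A,g_A,\delta_A)\to(f_B,g_B,\delta_B)\to(f_C,g_C,\delta_C)$, and $(f_A,f_B,f_C)$ and $(g_A,g_B,g_C)$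 are morphisms between the $\mathbb E$-triangles $(i_1,p_1,\varepsilon_1)\to(i_2,p_2,\varepsilon_2)\to(i_3,p_3,\varepsilon_3)$. -/

import Mathlib

open CategoryTheory CategoryTheory.Limits Opposite

universe w v u

namespace Extri

section

variable {C : Type u} [Category.{v} C]

/-- A sequence `X ⟶ Y ⟶ Z` in which the two end terms `X` and `Z` are fixed. -/
structure Seq (X Z : C) where
  /-- the middle term -/
  mid : C
  /-- the first morphism -/
  f : X ⟶ mid
  /-- the second morphism -/
  g : mid ⟶ Z

/-- Two sequences with the same end terms are equivalent if there is an isomorphism between the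
middle terms which is compatible with the identities of the end terms. -/
instance seqSetoid (X Z : C) : Setoid (Seq X Z) where
  r S T := ∃ φ : S.mid ≅ T.mid, S.f ≫ φ.hom = T.f ∧ φ.hom ≫ T.g = S.g
  iseqv :=
    { refl := fun S => ⟨Iso.refl _, by simp, by simp⟩
      symm := by
        rintro S T ⟨φ, h₁, h₂⟩
        exact ⟨φ.symm, by simp [← h₁], by simp [← h₂]⟩
      trans := by
        rintro S T U ⟨φ, h₁, h₂⟩ ⟨ψ, h₃, h₄⟩
        refine ⟨φ ≪≫ ψ, ?_, ?_⟩
        · rw [Iso.trans_hom, ← Category.assoc, h₁, h₃]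
        · rw [Iso.trans_hom, Category.assoc, h₄, h₂] }

/-- Equivalence classes of sequences `X ⟶ Y ⟶ Z` with fixed end terms `X` and `Z`. -/
abbrev SeqClass (X Z : C) := Quotient (seqSetoid X Z)

/-- The abelian group `𝔼(Z, X)` of extensions. -/
abbrev Extn (E : Cᵒᵖ ⥤ C ⥤ AddCommGrpCat.{w}) (Z X : C) : Type w := (E.obj (op Z)).obj X

variable {E : Cᵒᵖ ⥤ C ⥤ AddCommGrpCat.{w}}

/-- `push α δ` is `α_* δ = 𝔼(Z, α)(δ)`. -/
def push {Z X X' : C} (α : X ⟶ X') (δ : Extn E Z X) : Extn E Z X' :=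
  (E.obj (op Z)).map α δ

/-- `pull γ δ` is `γ^* δ = 𝔼(γ, X)(δ)`. -/
def pull {Z' Z X : C} (γ : Z' ⟶ Z) (δ : Extn E Z X) : Extn E Z' X :=
  (E.map γ.op).app X δ

/-- An assignment, to every extension `δ ∈ 𝔼(Z, X)`, of an equivalence class of sequences
`X ⟶ Y ⟶ Z`. -/
abbrev Assignment (E : Cᵒᵖ ⥤ C ⥤ AddCommGrpCat.{w}) :=
  ∀ Z X : C, Extn E Z X → SeqClass X Z

/-- The sequence `X ⟶ Y ⟶ Z` given by `f` and `g` realizes `δ`, that is, `𝔰(δ) = [X ⟶ Y ⟶ Z]`.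
When `(C, 𝔼, 𝔰)` is extriangulated, this says that `X ⟶ Y ⟶ Z ⇢ δ` is an `𝔼`-triangle. -/
def IsTriangle (s : Assignment E) {X Y Z : C} (f : X ⟶ Y) (g : Y ⟶ Z) (δ : Extn E Z X) : Prop :=
  s Z X δ = Quotient.mk (seqSetoid X Z) ⟨Y, f, g⟩

/-- The triple `(α, β, γ)` is a morphism from the `𝔼`-triangle `(f, g, δ)` to the `𝔼`-triangle
`(f', g', δ')`. -/
structure IsMorphism {X Y Z X' Y' Z' : C}
    (f : X ⟶ Y) (g : Y ⟶ Z) (δ : Extn E Z X)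
    (f' : X' ⟶ Y') (g' : Y' ⟶ Z') (δ' : Extn E Z' X')
    (α : X ⟶ X') (β : Y ⟶ Y') (γ : Z ⟶ Z') : Prop where
  comm_left : f ≫ β = α ≫ f'
  comm_right : g ≫ γ = β ≫ g'
  comm_ext : push α δ = pull γ δ'

/-- `f` is an `𝔼`-inflation. -/
def IsInflation (s : Assignment E) {X Y : C} (f : X ⟶ Y) : Prop :=
  ∃ (Z : C) (g : Y ⟶ Z) (δ : Extn E Z X), IsTriangle s f g δ

/-- `g` is an `𝔼`-deflation. -/
def IsDeflation (s : Assignment E) {Y Z : C} (g : Y ⟶ Z) : Prop :=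
  ∃ (X : C) (f : X ⟶ Y) (δ : Extn E Z X), IsTriangle s f g δ

/-- `f'` is a retract (in the arrow category) of some `𝔼`-inflation. -/
def IsRetractOfInflation (s : Assignment E) {A' B' : C} (f' : A' ⟶ B') : Prop :=
  ∃ (A B : C) (f : A ⟶ B), IsInflation s f ∧ Nonempty (RetractArrow f' f)

/-- `f'` is a retract (in the arrow category) of some `𝔼`-deflation. -/
def IsRetractOfDeflation (s : Assignment E) {A' B' : C} (f' : A' ⟶ B') : Prop :=
  ∃ (A B : C) (f : A ⟶ B), IsDeflation s f ∧ Nonempty (RetractArrow f' f)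

/-- A `3 × 3` diagram: six `𝔼`-triangles, namely the rows `(f_A, g_A, δ_A)`, `(f_B, g_B, δ_B)`,
`(f_C, g_C, δ_C)` and the columns `(i₁, p₁, ε₁)`, `(i₂, p₂, ε₂)`, `(i₃, p₃, ε₃)`, such that
`(i₁, i₂, i₃)`, `(p₁, p₂, p₃)`, `(f_A, f_B, f_C)` and `(g_A, g_B, g_C)` are morphisms of
`𝔼`-triangles. -/
structure IsThreeByThree (s : Assignment E) {A₁ A₂ A₃ B₁ B₂ B₃ C₁ C₂ C₃ : C}
    (fA : A₁ ⟶ A₂) (gA : A₂ ⟶ A₃) (δA : Extn E A₃ A₁)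
    (fB : B₁ ⟶ B₂) (gB : B₂ ⟶ B₃) (δB : Extn E B₃ B₁)
    (fC : C₁ ⟶ C₂) (gC : C₂ ⟶ C₃) (δC : Extn E C₃ C₁)
    (i₁ : A₁ ⟶ B₁) (p₁ : B₁ ⟶ C₁) (ε₁ : Extn E C₁ A₁)
    (i₂ : A₂ ⟶ B₂) (p₂ : B₂ ⟶ C₂) (ε₂ : Extn E C₂ A₂)
    (i₃ : A₃ ⟶ B₃) (p₃ : B₃ ⟶ C₃) (ε₃ : Extn E C₃ A₃) : Prop where
  rowA : IsTriangle s fA gA δA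
  rowB : IsTriangle s fB gB δB
  rowC : IsTriangle s fC gC δC
  col₁ : IsTriangle s i₁ p₁ ε₁
  col₂ : IsTriangle s i₂ p₂ ε₂
  col₃ : IsTriangle s i₃ p₃ ε₃
  mor_i : IsMorphism fA gA δA fB gB δB i₁ i₂ i₃
  mor_p : IsMorphism fB gB δB fC gC δC p₁ p₂ p₃
  mor_f : IsMorphism i₁ p₁ ε₁ i₂ p₂ ε₂ fA fB fC
  mor_g : IsMorphism i₂ p₂ ε₂ i₃ p₃ ε₃ gA gB gC

end

section

variable {C : Type u} [Category.{v} C] [Preadditive C]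

/-- An additive category is weakly idempotent complete if every section has a cokernel. -/
def WeaklyIdempotentComplete (C : Type u) [Category.{v} C] [Preadditive C] : Prop :=
  ∀ ⦃A B : C⦄ (f : A ⟶ B), IsSplitMono f → HasCokernel f

variable [HasZeroObject C] [HasBinaryBiproducts C] {E : Cᵒᵖ ⥤ C ⥤ AddCommGrpCat.{w}}

/-- The direct sum `δ ⊕ δ' ∈ 𝔼(Z ⊕ Z', X ⊕ X')` of two extensions: the element whose component in
`𝔼(Z, X)` is `δ`, whose component in `𝔼(Z', X')` is `δ'`, and whose components in `𝔼(Z, X')` and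
`𝔼(Z', X)` vanish. -/
noncomputable def dirSum {X Z X' Z' : C} (δ : Extn E Z X) (δ' : Extn E Z' X') :
    Extn E (Z ⊞ Z') (X ⊞ X') :=
  pull biprod.fst (push biprod.inl δ) + pull biprod.snd (push biprod.inr δ')

/-- The triplet `(C, 𝔼, 𝔰)`, where `C` is an additive category, is an extriangulated category in
the sense of Nakaoka and Palu. -/
structure IsExtriangulated (E : Cᵒᵖ ⥤ C ⥤ AddCommGrpCat.{w}) (s : Assignment E) : Prop where
  /-- ET1: `𝔼` is additive in the covariant variable. -/
  additive_right : ∀ Z : Cᵒᵖ, (E.obj Z).Additive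
  /-- ET1: `𝔼` is additive in the contravariant variable. -/
  additive_left : ∀ X : C, (E.flip.obj X).Additive
  /-- ET2: `𝔰` is a realization. -/
  realization : ∀ {X Y Z X' Y' Z' : C}
    (f : X ⟶ Y) (g : Y ⟶ Z) (δ : Extn E Z X) (f' : X' ⟶ Y') (g' : Y' ⟶ Z') (δ' : Extn E Z' X'),
    IsTriangle s f g δ → IsTriangle s f' g' δ' →
    ∀ (α : X ⟶ X') (γ : Z ⟶ Z'), push α δ = pull γ δ' →
    ∃ β : Y ⟶ Y', f ≫ β = α ≫ f' ∧ g ≫ γ = β ≫ g'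
  /-- ET2: the split extension is realized by the split sequence. -/
  realizes_zero : ∀ X Z : C,
    IsTriangle s (biprod.inl : X ⟶ X ⊞ Z) (biprod.snd : X ⊞ Z ⟶ Z) (0 : Extn E Z X)
  /-- ET2: `δ ⊕ δ'` is realized by the direct sum of the sequences which realize `δ` and `δ'`. -/
  realizes_dirSum : ∀ {X Y Z X' Y' Z' : C}
    (f : X ⟶ Y) (g : Y ⟶ Z) (δ : Extn E Z X) (f' : X' ⟶ Y') (g' : Y' ⟶ Z') (δ' : Extn E Z' X'),
    IsTriangle s f g δ → IsTriangle s f' g' δ' →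
    IsTriangle s (biprod.map f f') (biprod.map g g') (dirSum δ δ')
  /-- ET3 -/
  et3 : ∀ {X Y Z X' Y' Z' : C}
    (f : X ⟶ Y) (g : Y ⟶ Z) (δ : Extn E Z X) (f' : X' ⟶ Y') (g' : Y' ⟶ Z') (δ' : Extn E Z' X'),
    IsTriangle s f g δ → IsTriangle s f' g' δ' →
    ∀ (α : X ⟶ X') (β : Y ⟶ Y'), f ≫ β = α ≫ f' →
    ∃ γ : Z ⟶ Z', IsMorphism f g δ f' g' δ' α β γ
  /-- ET3ᵒᵖ -/
  et3_op : ∀ {X Y Z X' Y' Z' : C}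
    (f : X ⟶ Y) (g : Y ⟶ Z) (δ : Extn E Z X) (f' : X' ⟶ Y') (g' : Y' ⟶ Z') (δ' : Extn E Z' X'),
    IsTriangle s f g δ → IsTriangle s f' g' δ' →
    ∀ (β : Y ⟶ Y') (γ : Z ⟶ Z'), g ≫ γ = β ≫ g' →
    ∃ α : X ⟶ X', IsMorphism f g δ f' g' δ' α β γ
  /-- ET4 -/
  et4 : ∀ {A B D M N : C}
    (f : A ⟶ B) (g : B ⟶ D) (δ : Extn E D A) (a : B ⟶ M) (b : M ⟶ N) (ε : Extn E N B),
    IsTriangle s f g δ → IsTriangle s a b ε →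
    ∃ (F : C) (m : A ⟶ M) (h : M ⟶ F) (θ : Extn E F A)
      (d : D ⟶ F) (q : F ⟶ N) (η : Extn E N D),
      IsTriangle s m h θ ∧ IsTriangle s d q η ∧
      f ≫ a = m ∧ a ≫ h = g ≫ d ∧ h ≫ q = b ∧
      pull d θ = δ ∧ push g ε = η ∧ push f θ = pull q ε
  /-- ET4ᵒᵖ -/
  et4_op : ∀ {A M F D N : C}
    (m : A ⟶ M) (h : M ⟶ F) (θ : Extn E F A) (d : D ⟶ F) (q : F ⟶ N) (η : Extn E N D),
    IsTriangle s m h θ → IsTriangle s d q η →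
    ∃ (B : C) (f : A ⟶ B) (g : B ⟶ D) (δ : Extn E D A)
      (a : B ⟶ M) (b : M ⟶ N) (ε : Extn E N B),
      IsTriangle s f g δ ∧ IsTriangle s a b ε ∧
      f ≫ a = m ∧ a ≫ h = g ≫ d ∧ h ≫ q = b ∧
      pull d θ = δ ∧ push g ε = η ∧ push f θ = pull q ε

/-- `(α, β, γ)` is a homotopic morphism from the `𝔼`-triangle `(f, g, δ)` to the `𝔼`-triangle
`(f', g', δ')`: it is a morphism which factors as `(1, β₂, γ) ∘ (α, β₁, 1)` through an
`𝔼`-triangle `X' ⟶ M ⟶ Z ⇢ η`, such that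
`X ⟶ Y ⊕ X' ⟶ M ⇢ t^* δ` with morphisms `(f, α)` and `(β₁, -k)`, and
`M ⟶ Z ⊕ Y' ⟶ Z' ⇢ k_* δ'` with morphisms `(-t, β₂)` and `(γ, g')`, are `𝔼`-triangles. -/
def IsHomotopic (s : Assignment E) {X Y Z X' Y' Z' : C}
    (f : X ⟶ Y) (g : Y ⟶ Z) (δ : Extn E Z X)
    (f' : X' ⟶ Y') (g' : Y' ⟶ Z') (δ' : Extn E Z' X')
    (α : X ⟶ X') (β : Y ⟶ Y') (γ : Z ⟶ Z') : Prop :=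
  IsTriangle s f g δ ∧ IsTriangle s f' g' δ' ∧ IsMorphism f g δ f' g' δ' α β γ ∧
  ∃ (M : C) (k : X' ⟶ M) (t : M ⟶ Z) (η : Extn E Z X') (β₁ : Y ⟶ M) (β₂ : M ⟶ Y'),
    IsTriangle s k t η ∧
    IsMorphism f g δ k t η α β₁ (𝟙 Z) ∧
    IsMorphism k t η f' g' δ' (𝟙 X') β₂ γ ∧
    β₁ ≫ β₂ = β ∧
    IsTriangle s (biprod.lift f α) (biprod.desc β₁ (-k)) (pull t δ) ∧
    IsTriangle s (biprod.lift (-t) β₂) (biprod.desc γ g') (push k δ')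

end

end Extri

set_option linter.unusedSectionVars false

namespace Extri

section

variable {C : Type u} [Category.{v} C] {E : Cᵒᵖ ⥤ C ⥤ AddCommGrpCat.{w}}

/-! To build `i₁`, pull the row `B` back along `i₃`, with middle term `M`. The triangle `M ⟶ A₃ ⊞ B₂
⟶ B₃` lets `(-gA, i₂)` lift to `β₁ : A₂ ⟶ M`, and a map over the identity of `A₃` is always half of
a homotopy cartesian square (`exists_left_of_lift`), which yields `i₁`. The morphism `gC` arises
dually from a pushout. Since `i₁ ≫ fB = fA ≫ i₂` is a composite of inflations, adding `i₁` as a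
second component keeps it an inflation, and `i₁` is a retract of the result; dually for `gC`.

If `C` is weakly idempotent complete, `i₁` itself is an inflation (`isInflation_of_comp`). In the
factorization `i₂ = β₁ ≫ β₂`, the homotopy squares give `β₁` the cone of `i₁` and `β₂` the cone of
`i₃`, so ET4 produces the third row.

Conversely, a section `f` is placed in a configuration of split triangles whose completion forces
`i₁ = f`. Thus `f` is a split inflation, and its cone is a cokernel. -/

@[simp]
lemma push_id {Z X : C} (δ : Extn E Z X) : push (𝟙 X) δ = δ := by
  simp [push]

@[simp]
lemma pull_id {Z X : C} (δ : Extn E Z X) : pull (𝟙 Z) δ = δ := by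
  simp [pull]

lemma push_comp {Z X X' X'' : C} (α : X ⟶ X') (β : X' ⟶ X'') (δ : Extn E Z X) :
    push (α ≫ β) δ = push β (push α δ) := by
  simp [push]

lemma pull_comp {Z'' Z' Z X : C} (α : Z'' ⟶ Z') (β : Z' ⟶ Z) (δ : Extn E Z X) :
    pull (α ≫ β) δ = pull α (pull β δ) := by
  simp [pull]

lemma push_pull {Z' Z X X' : C} (α : X ⟶ X') (γ : Z' ⟶ Z) (δ : Extn E Z X) :
    push α (pull γ δ) = pull γ (push α δ) := by
  simp only [push, pull]
  exact congrArg (fun h => h.hom δ) ((E.map γ.op).naturality α).symm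

@[simp]
lemma push_zero {Z X X' : C} (α : X ⟶ X') : push α (0 : Extn E Z X) = 0 :=
  map_zero ((E.obj (op Z)).map α).hom

@[simp]
lemma pull_zero {Z' Z X : C} (γ : Z' ⟶ Z) : pull γ (0 : Extn E Z X) = 0 :=
  map_zero ((E.map γ.op).app X).hom

variable {s : Assignment E}

lemma exists_triangle (s : Assignment E) {Z X : C} (δ : Extn E Z X) :
    ∃ (Y : C) (f : X ⟶ Y) (g : Y ⟶ Z), IsTriangle s f g δ := by
  obtain ⟨⟨Y, f, g⟩, h⟩ := Quotient.exists_rep (s Z X δ)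
  exact ⟨Y, f, g, h.symm⟩

lemma IsTriangle.of_mid_iso {X Y Y' Z : C} {f : X ⟶ Y} {g : Y ⟶ Z} {δ : Extn E Z X}
    (h : IsTriangle s f g δ) {f' : X ⟶ Y'} {g' : Y' ⟶ Z} (φ : Y ≅ Y')
    (hf : f ≫ φ.hom = f') (hg : φ.hom ≫ g' = g) : IsTriangle s f' g' δ :=
  Eq.trans h (Quotient.sound ⟨φ, hf, hg⟩)

lemma IsTriangle.exists_mid_iso {X Y Y' Z : C} {f : X ⟶ Y} {g : Y ⟶ Z} {δ : Extn E Z X}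
    (h : IsTriangle s f g δ) {f' : X ⟶ Y'} {g' : Y' ⟶ Z} (h' : IsTriangle s f' g' δ) :
    ∃ φ : Y ≅ Y', f ≫ φ.hom = f' ∧ φ.hom ≫ g' = g :=
  Quotient.exact (Eq.trans (Eq.symm h) h')

end

/-! ### Criteria for isomorphisms in a preadditive category -/

section

variable {C : Type u} [Category.{v} C] [Preadditive C]

/-- Writing `u = 1 + n` with `n² = 0`, the inverse is `1 - n`. -/
lemma isIso_of_sub_id_sq_zero {X : C} (u : X ⟶ X) (h : (u - 𝟙 X) ≫ (u - 𝟙 X) = 0) :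
    IsIso u := by
  have h' : u ≫ u - u - (u - 𝟙 X) = 0 := by simpa [Preadditive.sub_comp, Preadditive.comp_sub] using h
  refine ⟨𝟙 X - (u - 𝟙 X), ?_, ?_⟩
  · rw [← sub_eq_zero, ← neg_eq_zero, ← h']
    simp only [Preadditive.comp_sub, Category.comp_id]
    abel
  · rw [← sub_eq_zero, ← neg_eq_zero, ← h']
    simp only [Preadditive.sub_comp, Category.id_comp]
    abel

lemma isIso_of_comp_isIso {X Y : C} (a : X ⟶ Y) (b : Y ⟶ X) (h : IsIso (a ≫ b))
    (h' : IsIso (b ≫ a)) : IsIso a := by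
  have : IsSplitMono a := ⟨⟨b ≫ inv (a ≫ b), by rw [← Category.assoc, IsIso.hom_inv_id]⟩⟩
  have : IsSplitEpi a := ⟨⟨inv (b ≫ a) ≫ b, by rw [Category.assoc, IsIso.inv_hom_id]⟩⟩
  exact isIso_of_mono_of_isSplitEpi a

end

open ZeroObject

section

variable {C : Type u} [Category.{v} C] [Preadditive C] [HasZeroObject C] [HasBinaryBiproducts C]
  {E : Cᵒᵖ ⥤ C ⥤ AddCommGrpCat.{w}} {s : Assignment E}

namespace IsExtriangulated

/-! ### Additivity of `𝔼` and split triangles -/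

section additivity

variable (hC : IsExtriangulated E s)
include hC

lemma add_push {Z X X' : C} (α β : X ⟶ X') (δ : Extn E Z X) :
    push (α + β) δ = push α δ + push β δ := by
  have := hC.additive_right (op Z)
  simp [push, (E.obj (op Z)).map_add]

lemma add_pull {Z' Z X : C} (α β : Z' ⟶ Z) (δ : Extn E Z X) :
    pull (α + β) δ = pull α δ + pull β δ := by
  have := hC.additive_left X
  have h := (E.flip.obj X).map_add (f := α.op) (g := β.op)
  exact congrArg (fun h => h.hom δ) h

lemma sub_push {Z X X' : C} (α β : X ⟶ X') (δ : Extn E Z X) :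
    push (α - β) δ = push α δ - push β δ := by
  rw [eq_sub_iff_add_eq, ← hC.add_push, sub_add_cancel]

lemma sub_pull {Z' Z X : C} (α β : Z' ⟶ Z) (δ : Extn E Z X) :
    pull (α - β) δ = pull α δ - pull β δ := by
  rw [eq_sub_iff_add_eq, ← hC.add_pull, sub_add_cancel]

/-- A split short exact sequence realizes the zero extension. -/
lemma isTriangle_of_splitting {X Y Z : C} (f : X ⟶ Y) (g : Y ⟶ Z) (r : Y ⟶ X) (t : Z ⟶ Y)
    (h₁ : f ≫ r = 𝟙 X) (h₂ : t ≫ g = 𝟙 Z) (h₃ : r ≫ f + g ≫ t = 𝟙 Y) (h₄ : f ≫ g = 0)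
    (h₅ : t ≫ r = 0) : IsTriangle s f g (0 : Extn E Z X) := by
  let φ : X ⊞ Z ≅ Y :=
    { hom := biprod.desc f t
      inv := biprod.lift r g
      hom_inv_id := by ext <;> simp [h₁, h₂, h₄, h₅]
      inv_hom_id := by simp [h₃] }
  exact (hC.realizes_zero X Z).of_mid_iso φ (by simp [φ]) (by ext <;> simp [φ, h₂, h₄])

lemma isTriangle_id_left (X : C) : IsTriangle s (𝟙 X) (0 : X ⟶ (0 : C)) (0 : Extn E 0 X) :=
  hC.isTriangle_of_splitting _ _ (𝟙 X) 0 (by simp) (by simp) (by simp) (by simp) (by simp)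

lemma isTriangle_id_right (X : C) : IsTriangle s (0 : (0 : C) ⟶ X) (𝟙 X) (0 : Extn E X 0) :=
  hC.isTriangle_of_splitting _ _ 0 (𝟙 X) (by simp) (by simp) (by simp) (by simp) (by simp)

end additivity

/-! ### Exactness, uniqueness of cones, pushouts and pullbacks -/

section exactness

variable (hC : IsExtriangulated E s) {X Y Z : C} {f : X ⟶ Y} {g : Y ⟶ Z} {δ : Extn E Z X}
  (h : IsTriangle s f g δ)
include hC h

/-- Comparison with `X ⟶ X ⟶ 0` via ET3: `f ≫ g` factors through zero. The next exactness statements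
likewise compare with a trivial triangle. -/
lemma comp_eq_zero : f ≫ g = 0 := by
  obtain ⟨γ, hγ⟩ := hC.et3 _ _ _ _ _ _ (hC.isTriangle_id_left X) h (𝟙 X) f (by simp)
  simpa using hγ.comm_right.symm

lemma push_self : push f δ = 0 := by
  obtain ⟨γ, hγ⟩ := hC.et3 _ _ _ _ _ _ h (hC.isTriangle_id_left Y) f (𝟙 Y) (by simp)
  simpa using hγ.comm_ext

lemma pull_self : pull g δ = 0 := by
  obtain ⟨γ, hγ⟩ := hC.et3_op _ _ _ _ _ _ (hC.isTriangle_id_right Y) h (𝟙 Y) g (by simp)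
  simpa using hγ.comm_ext.symm

lemma exists_lift {W : C} (x : W ⟶ Y) (hx : x ≫ g = 0) : ∃ v : W ⟶ X, v ≫ f = x := by
  obtain ⟨v, hv⟩ := hC.et3_op _ _ _ _ _ _ (hC.isTriangle_id_left W) h x 0 (by simp [hx])
  exact ⟨v, by simpa using hv.comm_left.symm⟩

lemma exists_desc {W : C} (x : Y ⟶ W) (hx : f ≫ x = 0) : ∃ v : Z ⟶ W, g ≫ v = x := by
  obtain ⟨v, hv⟩ := hC.et3 _ _ _ _ _ _ h (hC.isTriangle_id_right W) 0 x (by simp [hx])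
  exact ⟨v, by simpa using hv.comm_right⟩

lemma exists_extension {W : C} (x : X ⟶ W) (hx : push x δ = 0) : ∃ v : Y ⟶ W, f ≫ v = x := by
  obtain ⟨β, hβ, -⟩ := hC.realization _ _ _ _ _ _ h (hC.realizes_zero W Z) x (𝟙 Z) (by simp [hx])
  exact ⟨β ≫ biprod.fst, by rw [← Category.assoc, hβ]; simp⟩

lemma exists_coextension {W : C} (x : W ⟶ Z) (hx : pull x δ = 0) : ∃ v : W ⟶ Y, v ≫ g = x := by
  obtain ⟨β, -, hβ⟩ := hC.realization _ _ _ _ _ _ (hC.realizes_zero X W) h (𝟙 X) x (by simp [hx])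
  exact ⟨biprod.inr ≫ β, by simp [← hβ]⟩

/-- The difference `u - 1` kills `δ`, so it extends along `f`; it also vanishes after composing with
`f`, so its square is zero. The two following lemmas use the same argument at the other terms. -/
lemma isIso_left_of_comp_eq (u : X ⟶ X) (hu : u ≫ f = f) (hδ : push u δ = δ) : IsIso u := by
  obtain ⟨v, hv⟩ := hC.exists_extension h (u - 𝟙 X) (by simp [hC.sub_push, hδ])
  apply isIso_of_sub_id_sq_zero
  nth_rw 2 [← hv]
  rw [← Category.assoc, Preadditive.sub_comp, hu]
  simp

lemma isIso_right_of_comp_eq (u : Z ⟶ Z) (hu : g ≫ u = g) (hδ : pull u δ = δ) : IsIso u := by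
  obtain ⟨v, hv⟩ := hC.exists_coextension h (u - 𝟙 Z) (by simp [hC.sub_pull, hδ])
  apply isIso_of_sub_id_sq_zero
  nth_rw 1 [← hv]
  rw [Category.assoc, Preadditive.comp_sub, hu]
  simp

lemma isIso_mid_of_comp_eq (u : Y ⟶ Y) (hf : f ≫ u = f) (hg : u ≫ g = g) : IsIso u := by
  obtain ⟨v, hv⟩ := hC.exists_desc h (u - 𝟙 Y) (by simp [hf])
  apply isIso_of_sub_id_sq_zero
  nth_rw 2 [← hv]
  rw [← Category.assoc, Preadditive.sub_comp, hg]
  simp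

/-- Two `𝔼`-triangles with the same deflation have isomorphic first terms. -/
lemma exists_left_iso {X' : C} {f' : X' ⟶ Y} {δ' : Extn E Z X'} (h' : IsTriangle s f' g δ') :
    ∃ φ : X ≅ X', φ.hom ≫ f' = f ∧ push φ.hom δ = δ' := by
  obtain ⟨a, ha⟩ := hC.et3_op _ _ _ _ _ _ h h' (𝟙 Y) (𝟙 Z) (by simp)
  obtain ⟨b, hb⟩ := hC.et3_op _ _ _ _ _ _ h' h (𝟙 Y) (𝟙 Z) (by simp)
  have ha₁ : a ≫ f' = f := by simpa using ha.comm_left.symm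
  have hb₁ : b ≫ f = f' := by simpa using hb.comm_left.symm
  have ha₂ : push a δ = δ' := by simpa using ha.comm_ext
  have hb₂ : push b δ' = δ := by simpa using hb.comm_ext
  have : IsIso a := isIso_of_comp_isIso a b
    (hC.isIso_left_of_comp_eq h _ (by simp [hb₁, ha₁]) (by rw [push_comp, ha₂, hb₂]))
    (hC.isIso_left_of_comp_eq h' _ (by simp [hb₁, ha₁]) (by rw [push_comp, hb₂, ha₂]))
  exact ⟨asIso a, ha₁, ha₂⟩

/-- Two `𝔼`-triangles with the same inflation have isomorphic third terms. -/
lemma exists_right_iso {Z' : C} {g' : Y ⟶ Z'} {δ' : Extn E Z' X} (h' : IsTriangle s f g' δ') :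
    ∃ φ : Z ≅ Z', g ≫ φ.hom = g' ∧ pull φ.hom δ' = δ := by
  obtain ⟨a, ha⟩ := hC.et3 _ _ _ _ _ _ h h' (𝟙 X) (𝟙 Y) (by simp)
  obtain ⟨b, hb⟩ := hC.et3 _ _ _ _ _ _ h' h (𝟙 X) (𝟙 Y) (by simp)
  have ha₁ : g ≫ a = g' := by simpa using ha.comm_right
  have hb₁ : g' ≫ b = g := by simpa using hb.comm_right
  have ha₂ : pull a δ' = δ := by simpa using ha.comm_ext.symm
  have hb₂ : pull b δ = δ' := by simpa using hb.comm_ext.symm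
  have : IsIso a := isIso_of_comp_isIso a b
    (hC.isIso_right_of_comp_eq h _ (by rw [← Category.assoc, ha₁, hb₁])
      (by rw [pull_comp, hb₂, ha₂]))
    (hC.isIso_right_of_comp_eq h' _ (by rw [← Category.assoc, hb₁, ha₁])
      (by rw [pull_comp, ha₂, hb₂]))
  exact ⟨asIso a, ha₁, ha₂⟩

/-- A sequence with an extension which is isomorphic to an `𝔼`-triangle is an `𝔼`-triangle. -/
lemma isTriangle_of_iso {X' Y' Z' : C} {f' : X' ⟶ Y'} {g' : Y' ⟶ Z'} {δ' : Extn E Z' X'}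
    (a : X ≅ X') (b : Y ≅ Y') (c : Z ≅ Z') (hf : f ≫ b.hom = a.hom ≫ f')
    (hg : g ≫ c.hom = b.hom ≫ g') (hδ : push a.hom δ = pull c.hom δ') :
    IsTriangle s f' g' δ' := by
  obtain ⟨Y'', f'', g'', h''⟩ := exists_triangle s δ'
  have hδ' : push a.inv δ' = pull c.inv δ := by
    have := congrArg (fun x => pull c.inv (push a.inv x)) hδ
    simp only [push_pull, ← push_comp, ← pull_comp] at this
    simpa using this.symm
  -- ET2 gives maps of middle terms in both directions, not mutually inverse ones. Each round trip
  -- fixes the inflation and the deflation, hence is invertible.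
  obtain ⟨β, hβ₁, hβ₂⟩ := hC.realization _ _ _ _ _ _ h h'' a.hom c.hom hδ
  obtain ⟨β', hβ'₁, hβ'₂⟩ := hC.realization _ _ _ _ _ _ h'' h a.inv c.inv hδ'
  have : IsIso β := isIso_of_comp_isIso β β'
    (hC.isIso_mid_of_comp_eq h _ (by rw [← Category.assoc, hβ₁, Category.assoc, hβ'₁]; simp)
      (by rw [Category.assoc, ← hβ'₂, ← Category.assoc, ← hβ₂]; simp))
    (hC.isIso_mid_of_comp_eq h'' _ (by rw [← Category.assoc, hβ'₁, Category.assoc, hβ₁]; simp)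
      (by rw [Category.assoc, ← hβ₂, ← Category.assoc, ← hβ'₂]; simp))
  refine h''.of_mid_iso ((asIso β).symm ≪≫ b) ?_ ?_
  · rw [← cancel_epi a.hom, ← hf]
    simp only [Iso.trans_hom, Iso.symm_hom, asIso_inv, ← Category.assoc, ← hβ₁]
    simp
  · simp [← hg, hβ₂]

/-- The direct sum of an `𝔼`-triangle and `W ⟶ W ⟶ 0`. -/
lemma isTriangle_map_id_left (W : C) :
    IsTriangle s (biprod.map f (𝟙 W)) (biprod.desc g 0) (push (biprod.inl : X ⟶ X ⊞ W) δ) := by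
  have h₁ := hC.realizes_dirSum _ _ _ _ _ _ h (hC.isTriangle_id_left W)
  let φ : Z ⊞ (0 : C) ≅ Z :=
    { hom := biprod.fst
      inv := biprod.inl
      hom_inv_id := by ext; all_goals simp
      inv_hom_id := by simp }
  exact hC.isTriangle_of_iso h₁ (Iso.refl _) (Iso.refl _) φ (by simp)
    (by ext <;> simp [φ]) (by simp [φ, dirSum])

/-- The direct sum of an `𝔼`-triangle and `0 ⟶ W ⟶ W`. -/
lemma isTriangle_map_id_right (W : C) :
    IsTriangle s (biprod.lift f 0) (biprod.map g (𝟙 W)) (pull (biprod.fst : Z ⊞ W ⟶ Z) δ) := by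
  have h₁ := hC.realizes_dirSum _ _ _ _ _ _ h (hC.isTriangle_id_right W)
  let φ : X ⊞ (0 : C) ≅ X :=
    { hom := biprod.fst
      inv := biprod.inl
      hom_inv_id := by ext; all_goals simp
      inv_hom_id := by simp }
  refine hC.isTriangle_of_iso h₁ φ (Iso.refl _) (Iso.refl _) (by ext <;> simp [φ]) (by simp) ?_
  simp [φ, dirSum, push_pull, ← push_comp]

/-- Pushing out an `𝔼`-triangle along a morphism out of its first term. -/
lemma exists_pushout {X' : C} (α : X ⟶ X') :
    ∃ (M : C) (k : X' ⟶ M) (t : M ⟶ Z) (β : Y ⟶ M), IsTriangle s k t (push α δ) ∧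
      f ≫ β = α ≫ k ∧ β ≫ t = g ∧
      IsTriangle s (biprod.lift f α) (biprod.desc β (-k)) (pull t δ) := by
  have h₁ : IsTriangle s (biprod.lift (𝟙 X) α) (biprod.desc α (-𝟙 X')) (0 : Extn E X' X) :=
    hC.isTriangle_of_splitting _ _ biprod.fst (biprod.lift 0 (-𝟙 X')) (by simp) (by simp)
      (by ext <;> simp) (by simp) (by simp)
  -- ET4 is applied to the factorization of `(f, α)` as the split inflation `(1, α)` followed by `f
  -- ⊞ 1`.
  obtain ⟨M, m, b, θ, k, t, η, hm, hk, rfl, hb, hbt, -, hη, hθ⟩ :=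
    hC.et4 _ _ _ _ _ _ h₁ (hC.isTriangle_map_id_left h X')
  have e₁ : biprod.inr ≫ b = -k := by
    have := congrArg (fun x => biprod.inr ≫ x) hb
    simpa using this
  have e₂ : f ≫ biprod.inl ≫ b = α ≫ k := by
    have := congrArg (fun x => biprod.inl ≫ x) hb
    simpa using this
  have e₃ : (biprod.inl ≫ b) ≫ t = g := by simp [hbt]
  rw [← push_comp, biprod.inl_desc] at hη
  have e₄ : θ = pull t δ := by
    have := congrArg (push biprod.fst) hθ
    rw [← push_comp, push_pull, ← push_comp] at this
    simpa using this
  refine ⟨M, k, t, biprod.inl ≫ b, hη ▸ hk, e₂, e₃, ?_⟩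
  rw [← e₄, ← e₁]
  convert hm using 1
  · ext <;> simp
  · ext <;> simp

/-- Pulling back an `𝔼`-triangle along a morphism into its third term. -/
lemma exists_pullback {Z' : C} (γ : Z' ⟶ Z) :
    ∃ (M : C) (k : X ⟶ M) (t : M ⟶ Z') (β : M ⟶ Y), IsTriangle s k t (pull γ δ) ∧
      k ≫ β = f ∧ t ≫ γ = β ≫ g ∧
      IsTriangle s (biprod.lift (-t) β) (biprod.desc γ g) (push k δ) := by
  have h₁ : IsTriangle s (biprod.lift (-𝟙 Z') γ) (biprod.desc γ (𝟙 Z)) (0 : Extn E Z Z') :=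
    hC.isTriangle_of_splitting _ _ (-biprod.fst) biprod.inr (by simp) (by simp)
      (by ext <;> simp) (by simp) (by simp)
  have h₂ : IsTriangle s (biprod.lift 0 f) (biprod.map (𝟙 Z') g)
      (pull (biprod.snd : Z' ⊞ Z ⟶ Z) δ) :=
    hC.isTriangle_of_iso (hC.isTriangle_map_id_right h Z') (Iso.refl _) (biprod.braiding _ _)
      (biprod.braiding _ _) (by ext <;> simp) (by ext <;> simp) (by simp [← pull_comp])
  -- Dually, `(γ, g)` factors as `1 ⊞ g` followed by the split deflation `(γ, 1)`.
  obtain ⟨M, k, t, η, b, q, ε, hk, hb, hkb, hbt, hq, hη, -, hε⟩ := hC.et4_op _ _ _ _ _ _ h₂ h₁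
  have e₁ : b ≫ biprod.fst = -t := by
    have := congrArg (fun x => x ≫ biprod.fst) hbt
    simpa using this
  have e₂ : (b ≫ biprod.snd) ≫ g = t ≫ γ := by
    have := congrArg (fun x => x ≫ biprod.snd) hbt
    simpa using this
  have e₃ : k ≫ b ≫ biprod.snd = f := by rw [← Category.assoc, hkb]; simp
  rw [← pull_comp, biprod.lift_snd] at hη
  have e₄ : ε = push k δ := by
    have := congrArg (pull biprod.inr) hε
    rw [← push_pull, ← pull_comp, ← pull_comp] at this
    simpa using this.symm
  refine ⟨M, k, t, b ≫ biprod.snd, hη ▸ hk, e₃, e₂.symm, ?_⟩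
  rw [← e₄, ← e₁]
  convert hb using 1
  · ext <;> simp
  · ext <;> simp [← hq]

end exactness

/-! ### Homotopic morphisms, cancellation of inflations and the `3 × 3` diagram -/

section

variable (hC : IsExtriangulated E s)
include hC

/-- A morphism into the middle term, over the identity of the third term, is always part of
a homotopy cocartesian square. -/
lemma exists_left_of_lift {X Y Z X' M : C} {f : X ⟶ Y} {g : Y ⟶ Z} {δ : Extn E Z X}
    {k : X' ⟶ M} {t : M ⟶ Z} {η : Extn E Z X'} (h : IsTriangle s f g δ)
    (h' : IsTriangle s k t η) (β : Y ⟶ M) (hβ : β ≫ t = g) :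
    ∃ α : X ⟶ X', f ≫ β = α ≫ k ∧ push α δ = η ∧
      IsTriangle s (biprod.lift f α) (biprod.desc β (-k)) (pull t δ) := by
  obtain ⟨P, k', t', β', h₁, hk', -, h₂⟩ := hC.exists_pullback h t
  let σ : M ⊞ Y ≅ M ⊞ Y :=
    { hom := biprod.desc biprod.inl (biprod.lift (-β) (𝟙 Y))
      inv := biprod.desc biprod.inl (biprod.lift β (𝟙 Y))
      hom_inv_id := by ext <;> simp
      inv_hom_id := by ext <;> simp }
  -- Because `β ≫ t = g`, a shear turns `(t, 0)` into `(t, g)`. This second triangle on the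
  -- deflation `(t, g)` identifies the pullback `P` with `Y ⊞ X'`, and `α` is read off from `X ⟶ P`.
  have h₃ : IsTriangle s (biprod.lift (-biprod.desc β (-k)) biprod.fst) (biprod.desc t g)
      (push (biprod.inr : X' ⟶ Y ⊞ X') η) :=
    hC.isTriangle_of_iso (hC.isTriangle_map_id_left h' Y) (biprod.braiding _ _) σ (Iso.refl _)
      (by ext <;> simp [σ]) (by ext <;> simp [σ, hβ]) (by
        rw [← push_comp, Iso.refl_hom, pull_id]
        congr 1
        ext <;> simp)
  obtain ⟨φ, hφ, hφ'⟩ := hC.exists_left_iso h₂ h₃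
  have e₁ : φ.hom ≫ biprod.desc β (-k) = t' := by
    have := congrArg (fun x => x ≫ biprod.fst) hφ
    simpa using this
  have e₂ : φ.hom ≫ biprod.fst = β' := by
    have := congrArg (fun x => x ≫ biprod.snd) hφ
    simpa using this
  have h₄ : IsTriangle s (biprod.lift f (k' ≫ φ.hom ≫ biprod.snd)) (biprod.desc β (-k))
      (pull t δ) := h₁.of_mid_iso φ (by ext <;> simp [e₂, hk']) e₁
  refine ⟨k' ≫ φ.hom ≫ biprod.snd, ?_, ?_, h₄⟩
  · have := hC.comp_eq_zero h₄
    rw [biprod.lift_desc, Preadditive.comp_neg, add_neg_eq_zero] at this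
    exact this
  · rw [push_comp, push_comp, hφ', ← push_comp]
    simp

/-- A morphism out of the middle term, over the identity of the first term, is always part of
a homotopy cartesian square. -/
lemma exists_right_of_desc {X' Y' Z' M Z : C} {f' : X' ⟶ Y'} {g' : Y' ⟶ Z'} {δ' : Extn E Z' X'}
    {k : X' ⟶ M} {t : M ⟶ Z} {η : Extn E Z X'} (h : IsTriangle s f' g' δ')
    (h' : IsTriangle s k t η) (β : M ⟶ Y') (hβ : k ≫ β = f') :
    ∃ γ : Z ⟶ Z', t ≫ γ = β ≫ g' ∧ pull γ δ' = η ∧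
      IsTriangle s (biprod.lift (-t) β) (biprod.desc γ g') (push k δ') := by
  obtain ⟨N, κ, τ, β', h₁, -, hτ, h₂⟩ := hC.exists_pushout h k
  let σ : M ⊞ Y' ≅ Y' ⊞ M :=
    { hom := biprod.desc (biprod.lift β (𝟙 M)) biprod.inl
      inv := biprod.desc biprod.inr (biprod.lift (𝟙 M) (-β))
      hom_inv_id := by ext <;> simp
      inv_hom_id := by ext <;> simp }
  have h₃ : IsTriangle s (biprod.lift f' k) (biprod.desc biprod.inr (-biprod.lift (-t) β))
      (pull (biprod.fst : Z ⊞ Y' ⟶ Z) η) :=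
    hC.isTriangle_of_iso (hC.isTriangle_map_id_right h' Y') (Iso.refl _) σ (Iso.refl _)
      (by ext <;> simp [σ, hβ]) (by ext <;> simp [σ]) (by simp)
  obtain ⟨ψ, hψ, hψ'⟩ := hC.exists_right_iso h₂ h₃
  have e₁ : κ ≫ ψ.hom = biprod.lift (-t) β := by
    have := congrArg (fun x => biprod.inr ≫ x) hψ
    simpa using this
  have e₂ : β' ≫ ψ.hom = biprod.inr := by
    have := congrArg (fun x => biprod.inl ≫ x) hψ
    simpa using this
  have e₃ : biprod.inr ≫ ψ.inv ≫ τ = g' := by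
    rw [← e₂]; simp [hτ]
  have h₄ : IsTriangle s (biprod.lift (-t) β) (biprod.desc (biprod.inl ≫ ψ.inv ≫ τ) g')
      (push k δ') := h₁.of_mid_iso ψ e₁ (by
        rw [← cancel_epi ψ.inv]; ext <;> simp [e₃])
  refine ⟨biprod.inl ≫ ψ.inv ≫ τ, ?_, ?_, h₄⟩
  · have := hC.comp_eq_zero h₄
    rw [biprod.lift_desc, Preadditive.neg_comp, neg_add_eq_zero] at this
    exact this
  · rw [pull_comp, pull_comp, ← hψ', ← pull_comp ψ.inv, Iso.inv_hom_id, pull_id, ← pull_comp]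
    simp

lemma exists_homotopic_left {A₁ A₂ A₃ B₁ B₂ B₃ : C}
    {fA : A₁ ⟶ A₂} {gA : A₂ ⟶ A₃} {δA : Extn E A₃ A₁}
    {fB : B₁ ⟶ B₂} {gB : B₂ ⟶ B₃} {δB : Extn E B₃ B₁}
    (hA : IsTriangle s fA gA δA) (hB : IsTriangle s fB gB δB)
    (i₂ : A₂ ⟶ B₂) (i₃ : A₃ ⟶ B₃) (hi : i₂ ≫ gB = gA ≫ i₃) :
    ∃ i₁ : A₁ ⟶ B₁, IsHomotopic s fA gA δA fB gB δB i₁ i₂ i₃ := by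
  obtain ⟨M, k, t, β₂, h₁, hk, ht, h₂⟩ := hC.exists_pullback hB i₃
  obtain ⟨β₁, hβ₁⟩ := hC.exists_lift h₂ (biprod.lift (-gA) i₂) (by simp [hi])
  have e₁ : β₁ ≫ t = gA := by
    have := congrArg (fun x => x ≫ biprod.fst) hβ₁
    simpa using this
  have e₂ : β₁ ≫ β₂ = i₂ := by
    have := congrArg (fun x => x ≫ biprod.snd) hβ₁
    simpa using this
  obtain ⟨i₁, e₃, e₄, h₃⟩ := hC.exists_left_of_lift hA h₁ β₁ e₁
  refine ⟨i₁, hA, hB, ⟨?_, hi.symm, e₄⟩, M, k, t, _, β₁, β₂, h₁, ⟨e₃, by simp [e₁], by simp [e₄]⟩,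
    ⟨by simp [hk], ht, by simp⟩, e₂, h₃, h₂⟩
  rw [← e₂, ← Category.assoc, e₃, Category.assoc, hk]

lemma exists_homotopic_right {A₁ A₂ A₃ B₁ B₂ B₃ : C}
    {fA : A₁ ⟶ A₂} {gA : A₂ ⟶ A₃} {δA : Extn E A₃ A₁}
    {fB : B₁ ⟶ B₂} {gB : B₂ ⟶ B₃} {δB : Extn E B₃ B₁}
    (hA : IsTriangle s fA gA δA) (hB : IsTriangle s fB gB δB)
    (i₁ : A₁ ⟶ B₁) (i₂ : A₂ ⟶ B₂) (hi : fA ≫ i₂ = i₁ ≫ fB) :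
    ∃ i₃ : A₃ ⟶ B₃, IsHomotopic s fA gA δA fB gB δB i₁ i₂ i₃ := by
  obtain ⟨M, k, t, β₁, h₁, hk, ht, h₂⟩ := hC.exists_pushout hA i₁
  obtain ⟨β₂, hβ₂⟩ := hC.exists_desc h₂ (biprod.desc i₂ (-fB)) (by simp [hi])
  have e₁ : k ≫ β₂ = fB := by
    have := congrArg (fun x => biprod.inr ≫ x) hβ₂
    simpa using this
  have e₂ : β₁ ≫ β₂ = i₂ := by
    have := congrArg (fun x => biprod.inl ≫ x) hβ₂
    simpa using this
  obtain ⟨i₃, e₃, e₄, h₃⟩ := hC.exists_right_of_desc hB h₁ β₂ e₁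
  refine ⟨i₃, hA, hB, ⟨hi, ?_, e₄.symm⟩, M, k, t, _, β₁, β₂, h₁, ⟨hk, by simp [ht], by simp⟩,
    ⟨by simp [e₁], e₃, by simp [e₄]⟩, e₂, h₂, h₃⟩
  rw [← e₂, ← ht, Category.assoc, e₃, Category.assoc]

lemma isInflation_comp {X Y Z : C} {f : X ⟶ Y} {g : Y ⟶ Z} (hf : IsInflation s f)
    (hg : IsInflation s g) : IsInflation s (f ≫ g) := by
  obtain ⟨_, _, _, hf⟩ := hf
  obtain ⟨_, _, _, hg⟩ := hg
  obtain ⟨F, m, h, θ, _, _, _, h₁, -, rfl, -⟩ := hC.et4 _ _ _ _ _ _ hf hg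
  exact ⟨F, h, θ, h₁⟩

lemma isDeflation_comp {X Y Z : C} {f : X ⟶ Y} {g : Y ⟶ Z} (hf : IsDeflation s f)
    (hg : IsDeflation s g) : IsDeflation s (f ≫ g) := by
  obtain ⟨_, _, _, hf⟩ := hf
  obtain ⟨_, _, _, hg⟩ := hg
  obtain ⟨B, _, _, _, a, b, ε, -, h₁, -, -, rfl, -⟩ := hC.et4_op _ _ _ _ _ _ hf hg
  exact ⟨B, a, ε, h₁⟩

lemma isInflation_lift {X Y X' : C} {f : X ⟶ Y} (hf : IsInflation s f) (α : X ⟶ X') :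
    IsInflation s (biprod.lift f α) := by
  obtain ⟨_, _, _, hf⟩ := hf
  obtain ⟨_, _, _, _, -, -, -, h⟩ := hC.exists_pushout hf α
  exact ⟨_, _, _, h⟩

lemma isDeflation_desc {Y Z Z' : C} {g : Y ⟶ Z} (hg : IsDeflation s g) (γ : Z' ⟶ Z) :
    IsDeflation s (biprod.desc γ g) := by
  obtain ⟨_, _, _, hg⟩ := hg
  obtain ⟨_, _, _, _, -, -, -, h⟩ := hC.exists_pullback hg γ
  exact ⟨_, _, _, h⟩

/-- The inflation is `(f ≫ g, f)`; `(g, 1) : Y ⟶ Z ⊞ Y` and the second projection exhibit `f` as its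
retract. -/
lemma isRetractOfInflation_of_comp {X Y Z : C} {f : X ⟶ Y} {g : Y ⟶ Z}
    (h : IsInflation s (f ≫ g)) : IsRetractOfInflation s f :=
  ⟨_, _, _, hC.isInflation_lift h f,
    ⟨{ i := Arrow.homMk (𝟙 X) (biprod.lift g (𝟙 Y))
         (show 𝟙 X ≫ biprod.lift (f ≫ g) f = f ≫ biprod.lift g (𝟙 Y) by ext <;> simp)
       r := Arrow.homMk (𝟙 X) biprod.snd (by simp)
       retract := by ext <;> simp }⟩⟩

lemma isRetractOfDeflation_of_comp {X Y Z : C} {f : X ⟶ Y} {g : Y ⟶ Z}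
    (h : IsDeflation s (f ≫ g)) : IsRetractOfDeflation s g :=
  ⟨_, _, _, hC.isDeflation_desc h g,
    ⟨{ i := Arrow.homMk biprod.inl (𝟙 Z) (by simp)
       r := Arrow.homMk (biprod.desc (𝟙 Y) f) (𝟙 Z)
         (show biprod.desc (𝟙 Y) f ≫ g = biprod.desc g (f ≫ g) ≫ 𝟙 Z by ext <;> simp)
       retract := by ext <;> simp }⟩⟩

/-- In a homotopy cartesian square, the morphism opposite to an inflation is again an inflation,
with the same cone. -/
lemma exists_triangle_of_homotopy_cartesian {M A B B' C' : C} {t : M ⟶ A} {b : M ⟶ B}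
    {i : A ⟶ B'} {g : B ⟶ B'} {θ : Extn E B' M} {p : B' ⟶ C'} {ε : Extn E C' A}
    (h₁ : IsTriangle s (biprod.lift (-t) b) (biprod.desc i g) θ) (h₂ : IsTriangle s i p ε)
    (hθ : pull i θ = 0) :
    ∃ e : Extn E C' M, IsTriangle s b (g ≫ p) e ∧ push t e = ε ∧ pull p e = θ := by
  obtain ⟨P, f, r, δ, a, b', ε', hf, ha, hfa, har, hb', hδ, hε, hε'⟩ :=
    hC.et4_op _ _ _ _ _ _ h₁ h₂
  obtain rfl : δ = 0 := by rw [← hδ, hθ]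
  obtain ⟨ρ, hρ⟩ := hC.exists_extension hf (𝟙 M) (by simp)
  have : Mono f := (SplitMono.mk ρ hρ).mono
  have hfr := hC.comp_eq_zero hf
  have hip := hC.comp_eq_zero h₂
  obtain ⟨σ₀, hσ₀⟩ := hC.exists_coextension hf (𝟙 A) (by simp)
  -- Two lifts of `i` along `(i, g)` differ by a map through `M`. Correcting `σ₀` by it makes `a`
  -- restrict to the inclusion of `A`.
  obtain ⟨z, hz⟩ := hC.exists_lift h₁ (σ₀ ≫ a - biprod.inl) (by
    rw [Preadditive.sub_comp, Category.assoc, har, ← Category.assoc, hσ₀]; simp)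
  obtain ⟨σ, hσa, hσr⟩ : ∃ σ : A ⟶ P, σ ≫ a = biprod.inl ∧ σ ≫ r = 𝟙 A :=
    ⟨σ₀ - z ≫ f, by simp [hfa, hz], by simp [hσ₀, hfr]⟩
  obtain ⟨π, hπ⟩ := hC.exists_lift hf (𝟙 P - r ≫ σ) (by simp [hσr])
  have hfπ : f ≫ π = 𝟙 M := by
    rw [← cancel_mono f, Category.assoc, hπ, Preadditive.comp_sub, ← Category.assoc, hfr]; simp
  have hσπ : σ ≫ π = 0 := by
    rw [← cancel_mono f, Category.assoc, hπ, Preadditive.comp_sub, ← Category.assoc, hσr]; simp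
  have hfa₁ : f ≫ a ≫ biprod.fst = -t := by rw [← Category.assoc, hfa]; simp
  have hfa₂ : f ≫ a ≫ biprod.snd = b := by rw [← Category.assoc, hfa]; simp
  have hσa₁ : σ ≫ a ≫ biprod.fst = 𝟙 A := by rw [← Category.assoc, hσa]; simp
  have hid : π ≫ f + r ≫ σ = 𝟙 P := by rw [hπ]; simp
  have hr : r = π ≫ t + a ≫ biprod.fst := by
    have h' : ∀ x : P ⟶ A, x = π ≫ f ≫ x + r ≫ σ ≫ x := fun x => by
      rw [← Category.assoc, ← Category.assoc r, ← Preadditive.add_comp, hid, Category.id_comp]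
    rw [h' (a ≫ biprod.fst), hfa₁, hσa₁]
    simp
  have haε' : push a ε' = 0 := hC.push_self ha
  obtain ⟨X, x, y, hx⟩ := exists_triangle s (push π ε')
  -- The shear by `t ≫ σ` cancels the component `-t` of `a` on `M`, so that `a` becomes diagonal and
  -- the summand `A` can be removed.
  let Φ : M ⊞ A ≅ P :=
    { hom := biprod.desc (f + t ≫ σ) σ
      inv := biprod.lift π (a ≫ biprod.fst)
      hom_inv_id := by ext <;> simp [hfπ, hσπ, hfa₁, hσa₁]
      inv_hom_id := by
        rw [biprod.lift_desc, ← hid, hr]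
        simp only [Preadditive.comp_add, Preadditive.add_comp, Category.assoc]
        abel }
  have h₃ : IsTriangle s (biprod.lift (π ≫ x) (a ≫ biprod.fst)) (biprod.desc y 0) ε' := by
    refine hC.isTriangle_of_iso (hC.isTriangle_map_id_left hx A) Φ (Iso.refl _) (Iso.refl _) ?_ ?_ ?_
    · ext
      · simp [Φ, reassoc_of% hfπ, reassoc_of% hσπ]
      · simp [Φ, hfa₁, hσa₁]
      · simp [Φ, reassoc_of% hσπ]
      · simp [Φ, hσa₁]
    · simp
    · have : π ≫ biprod.inl ≫ Φ.hom = 𝟙 P - a ≫ biprod.fst ≫ σ := by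
        rw [← Φ.inv_hom_id]; simp [Φ]
      rw [← push_comp, ← push_comp, this, hC.sub_push, push_comp a, haε']
      simp
  obtain ⟨φ, hφ₁, hφ₂⟩ := h₃.exists_mid_iso ha
  have hinr : biprod.inr ≫ φ.hom = biprod.inl := by
    have := congrArg (fun x => σ ≫ x) hφ₁
    rw [← hσa, ← this, ← Category.assoc]
    congr 1
    ext
    · simp [reassoc_of% hσπ]
    · simp [hσa₁]
  have hinl : biprod.inl ≫ φ.inv = biprod.inr := by rw [← hinr]; simp
  -- Since `φ` matches the two copies of `A`, it induces an isomorphism of their complements.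
  let χ : X ≅ B :=
    { hom := biprod.inl ≫ φ.hom ≫ biprod.snd
      inv := biprod.inr ≫ φ.inv ≫ biprod.fst
      hom_inv_id := by
        have h' : (biprod.snd : A ⊞ B ⟶ B) ≫ biprod.inr = 𝟙 _ - biprod.fst ≫ biprod.inl :=
          eq_sub_of_add_eq' biprod.total
        simp only [Category.assoc]
        rw [← Category.assoc biprod.snd, h']
        simp only [Preadditive.sub_comp, Preadditive.comp_sub, Category.assoc, Category.id_comp]
        rw [← Category.assoc biprod.inl φ.inv, hinl]
        simp
      inv_hom_id := by
        have h' : (biprod.fst : X ⊞ A ⟶ X) ≫ biprod.inl = 𝟙 _ - biprod.snd ≫ biprod.inr :=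
          eq_sub_of_add_eq biprod.total
        simp only [Category.assoc]
        rw [← Category.assoc biprod.fst, h']
        simp only [Preadditive.sub_comp, Preadditive.comp_sub, Category.assoc, Category.id_comp]
        rw [← Category.assoc biprod.inr φ.hom, hinr]
        simp }
  refine ⟨push π ε', hx.of_mid_iso χ ?_ ?_, ?_, ?_⟩
  · have h' : x ≫ biprod.inl = f ≫ biprod.lift (π ≫ x) (a ≫ biprod.fst) + t ≫ biprod.inr := by
      ext
      · simp [reassoc_of% hfπ]
      · simp [hfa₁]
    have h'' : (x ≫ biprod.inl) ≫ φ.hom ≫ biprod.snd = b := by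
      rw [h', Preadditive.add_comp, Category.assoc, ← Category.assoc _ φ.hom, hφ₁, hfa₂,
        Category.assoc, ← Category.assoc biprod.inr, hinr]
      simp
    simpa [χ] using h''
  · have h' : b' = biprod.snd ≫ g ≫ p := by
      rw [← hb']; ext <;> simp [hip]
    have := congrArg (fun x => biprod.inl ≫ x) hφ₂
    simpa [χ, h'] using this
  · rw [← push_comp, ← hε]
    have : π ≫ t = r - a ≫ biprod.fst := by rw [hr]; simp
    rw [this, hC.sub_push, push_comp a, haε']
    simp
  · rw [← push_pull, ← hε', ← push_comp, hfπ, push_id]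

/-- In a weakly idempotent complete extriangulated category, `f` is an inflation whenever `f ≫ g`
is one. -/
lemma isInflation_of_comp (hw : WeaklyIdempotentComplete C) {A B W : C} {f : A ⟶ B} {g : B ⟶ W}
    (h : IsInflation s (f ≫ g)) : IsInflation s f := by
  obtain ⟨Q, q', δ, h⟩ := hC.isInflation_lift h f
  -- The shear by `-g` turns the inflation `(f ≫ g, f)` into `(f, 0)`. Its cone `Q` then contains
  -- `W` as a retract, and the cokernel of that section splits `W` off.
  let σ : W ⊞ B ≅ B ⊞ W :=
    { hom := biprod.desc biprod.inr (biprod.lift (𝟙 B) (-g))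
      inv := biprod.desc (biprod.lift g (𝟙 B)) biprod.inl
      hom_inv_id := by ext <;> simp
      inv_hom_id := by ext <;> simp }
  obtain ⟨q, hq⟩ : ∃ q : B ⊞ W ⟶ Q, IsTriangle s (biprod.lift f 0) q δ :=
    ⟨σ.inv ≫ q', h.of_mid_iso σ (by ext <;> simp [σ]) (by simp)⟩
  obtain ⟨r, hr⟩ := hC.exists_desc hq biprod.snd (by simp)
  have hwr : (biprod.inr ≫ q) ≫ r = 𝟙 W := by simp [hr]
  have := hw (biprod.inr ≫ q) ⟨⟨⟨r, hwr⟩⟩⟩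
  generalize hj : biprod.inr ≫ q = j at *
  let π := cokernel.π j
  obtain ⟨ι, hι⟩ : ∃ ι : cokernel j ⟶ Q, π ≫ ι = 𝟙 Q - r ≫ j :=
    ⟨cokernel.desc j (𝟙 Q - r ≫ j) (by simp [← Category.assoc, hwr]), by simp [π]⟩
  have hjπ : j ≫ π = 0 := cokernel.condition j
  have hιπ : ι ≫ π = 𝟙 _ := by
    rw [← cancel_epi π, ← Category.assoc, hι]; simp [hjπ]
  have hιr : ι ≫ r = 0 := by
    rw [← cancel_epi π, ← Category.assoc, hι]; simp [hwr]
  obtain ⟨X, x, y, hx⟩ := exists_triangle s (pull ι δ)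
  let Φ : cokernel j ⊞ W ≅ Q :=
    { hom := biprod.desc ι j
      inv := biprod.lift π r
      hom_inv_id := by ext <;> simp [hιπ, hιr, hjπ, hwr]
      inv_hom_id := by simp [hι] }
  have hjδ : pull j δ = 0 := by rw [← hj, pull_comp, hC.pull_self hq, pull_zero]
  -- As `j` pulls `δ` back to zero, `δ` is determined by its restriction to the complement of `W`.
  -- Comparing realizations over `W` then gives `X ≅ B`.
  have h₃ : IsTriangle s (biprod.lift x 0) (biprod.desc (y ≫ ι) j) δ := by
    refine hC.isTriangle_of_iso (hC.isTriangle_map_id_right hx W) (Iso.refl _) (Iso.refl _) Φ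
      (by simp) (by ext <;> simp [Φ]) ?_
    have : biprod.fst ≫ ι = Φ.hom - biprod.snd ≫ j := by ext <;> simp [Φ]
    rw [← pull_comp, this, hC.sub_pull, pull_comp _ j, hjδ]
    simp
  obtain ⟨φ, hφ₁, hφ₂⟩ := h₃.exists_mid_iso hq
  have hsnd : φ.hom ≫ biprod.snd = biprod.snd := by
    rw [← hr, ← Category.assoc, hφ₂]
    ext <;> simp [hιr, hwr]
  have hsnd' : φ.inv ≫ biprod.snd = biprod.snd := by
    rw [Iso.inv_comp_eq, hsnd]
  let χ : X ≅ B :=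
    { hom := biprod.inl ≫ φ.hom ≫ biprod.fst
      inv := biprod.inl ≫ φ.inv ≫ biprod.fst
      hom_inv_id := by
        have h' : (biprod.fst : B ⊞ W ⟶ B) ≫ biprod.inl = 𝟙 _ - biprod.snd ≫ biprod.inr :=
          eq_sub_of_add_eq biprod.total
        simp only [Category.assoc]
        rw [← Category.assoc biprod.fst, h']
        simp only [Preadditive.sub_comp, Preadditive.comp_sub, Category.assoc, Category.id_comp]
        rw [← Category.assoc φ.hom biprod.snd, hsnd]
        simp
      inv_hom_id := by
        have h' : (biprod.fst : X ⊞ W ⟶ X) ≫ biprod.inl = 𝟙 _ - biprod.snd ≫ biprod.inr :=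
          eq_sub_of_add_eq biprod.total
        simp only [Category.assoc]
        rw [← Category.assoc biprod.fst, h']
        simp only [Preadditive.sub_comp, Preadditive.comp_sub, Category.assoc, Category.id_comp]
        rw [← Category.assoc φ.inv biprod.snd, hsnd']
        simp }
  refine ⟨_, χ.inv ≫ y, _, hx.of_mid_iso χ ?_ (by simp)⟩
  have h' : biprod.lift x (0 : A ⟶ W) = x ≫ biprod.inl := by ext <;> simp
  have := congrArg (fun x => x ≫ biprod.fst) hφ₁
  simpa [χ, h'] using this

/-- A split monomorphism which is an inflation has a cokernel. -/
lemma hasCokernel_of_isInflation {A B : C} (f : A ⟶ B) [IsSplitMono f] (h : IsInflation s f) :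
    HasCokernel f := by
  obtain ⟨Z, g, δ, h⟩ := h
  have hδ : δ = 0 := by
    have := congrArg (push (retraction f)) (hC.push_self h)
    simpa [← push_comp] using this
  obtain ⟨t, ht⟩ := hC.exists_coextension h (𝟙 Z) (by simp [hδ])
  have hg : Epi g := (SplitEpi.mk t ht).epi
  have hc := fun (W : C) (x : B ⟶ W) (hx : f ≫ x = 0) => hC.exists_desc h x hx
  choose d hd using hc
  exact ⟨⟨⟨_, CokernelCofork.IsColimit.ofπ g (hC.comp_eq_zero h) (fun x hx => d _ x hx)
    (fun x hx => hd _ x hx)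
    (fun x hx m hm => by rw [← cancel_epi g, hm, hd])⟩⟩⟩

/-- The `3 × 3` lemma, when the first column is an inflation in a homotopic morphism. -/
lemma exists_threeByThree {A₁ A₂ A₃ B₁ B₂ B₃ C₂ C₃ : C}
    {fA : A₁ ⟶ A₂} {gA : A₂ ⟶ A₃} {δA : Extn E A₃ A₁}
    {fB : B₁ ⟶ B₂} {gB : B₂ ⟶ B₃} {δB : Extn E B₃ B₁}
    {i₁ : A₁ ⟶ B₁} {i₂ : A₂ ⟶ B₂} {p₂ : B₂ ⟶ C₂} {ε₂ : Extn E C₂ A₂}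
    {i₃ : A₃ ⟶ B₃} {p₃ : B₃ ⟶ C₃} {ε₃ : Extn E C₃ A₃}
    (h : IsHomotopic s fA gA δA fB gB δB i₁ i₂ i₃) (hi₁ : IsInflation s i₁)
    (h₂ : IsTriangle s i₂ p₂ ε₂) (h₃ : IsTriangle s i₃ p₃ ε₃) :
    ∃ (C₁ : C) (p₁ : B₁ ⟶ C₁) (ε₁ : Extn E C₁ A₁)
        (fC : C₁ ⟶ C₂) (gC : C₂ ⟶ C₃) (δC : Extn E C₃ C₁),
        IsThreeByThree s fA gA δA fB gB δB fC gC δC i₁ p₁ ε₁ i₂ p₂ ε₂ i₃ p₃ ε₃ := by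
  obtain ⟨hA, hB, hi, M, k, t, η, β₁, β₂, hM, m₁, m₂, rfl, t₁, t₂⟩ := h
  obtain ⟨C₁, p₁, ε₁, h₁⟩ := hi₁
  have hη : η = pull i₃ δB := by simpa using m₂.comm_ext
  have hβ₁t : β₁ ≫ t = gA := by simpa using m₁.comm_right.symm
  have hkβ₂ : k ≫ β₂ = fB := by simpa using m₂.comm_left
  obtain ⟨e, he, hte, hpe⟩ := hC.exists_triangle_of_homotopy_cartesian t₂ h₃ (by
    rw [← push_pull, ← hη, hC.push_self hM])
  obtain ⟨c, hc, hkc⟩ : ∃ c : M ⟶ C₁, IsTriangle s β₁ c (push fA ε₁) ∧ k ≫ c = p₁ := by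
    obtain ⟨N, κ, c, b, hκ, -, hbc, hN⟩ := hC.exists_pushout h₁ fA
    have hN' := hN.of_mid_iso (biprod.braiding _ _) (f' := biprod.lift fA i₁)
      (g' := biprod.desc (-κ) b) (by ext <;> simp) (by ext <;> simp)
    obtain ⟨ψ, hψ, -⟩ := hC.exists_right_iso hN' t₁
    have e₁ : b ≫ ψ.hom = -k := by
      have := congrArg (fun x => biprod.inr ≫ x) hψ
      simpa using this
    have e₂ : κ ≫ ψ.hom = -β₁ := by
      have := congrArg (fun x => biprod.inl ≫ x) hψ
      simpa [neg_eq_iff_eq_neg] using this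
    -- The two triangles on `(fA, i₁)` have deflations with opposite signs, hence the negated
    -- isomorphism.
    let ψ' : N ≅ M :=
      { hom := -ψ.hom
        inv := -ψ.inv
        hom_inv_id := by simp
        inv_hom_id := by simp }
    refine ⟨ψ'.inv ≫ c, hκ.of_mid_iso ψ' (by simp [ψ', e₂]) (by simp), ?_⟩
    have e₃ : k = b ≫ ψ'.hom := by simp [ψ', e₁]
    rw [e₃, ← hbc]; simp
  -- ET4 for `β₁ ≫ β₂ = i₂`: its cone `F` is isomorphic to `C₂`, and the triangle `C₁ ⟶ F ⟶ C₃`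
  -- becomes the third row.
  obtain ⟨F, _, h', θ, d, q, η', hF, hd, rfl, hch, hq, hdθ, hcη, hθ⟩ := hC.et4 _ _ _ _ _ _ hc he
  obtain ⟨ψ, hψ, hψ'⟩ := hC.exists_right_iso hF h₂
  have hgC : p₂ ≫ ψ.inv ≫ q = gB ≫ p₃ := by rw [← hψ]; simp [hq]
  have hfC : c ≫ d ≫ ψ.hom = β₂ ≫ p₂ := by
    rw [← Category.assoc, ← hch, Category.assoc, hψ]
  have hψθ : pull ψ.inv θ = ε₂ := by rw [← hψ', ← pull_comp]; simp
  refine ⟨C₁, p₁, ε₁, d ≫ ψ.hom, ψ.inv ≫ q, η', hA, hB, hd.of_mid_iso ψ rfl (by simp), h₁, h₂, h₃,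
    hi, ⟨?_, hgC.symm, ?_⟩, ⟨hi.comm_left.symm, ?_, ?_⟩, ⟨hi.comm_right.symm, hgC, ?_⟩⟩
  · rw [← hkβ₂, ← hkc, Category.assoc, Category.assoc, hfC]
  · rw [← hcη, ← push_pull, hpe, ← push_comp, hkc]
  · rw [← hkβ₂, ← hkc, Category.assoc, Category.assoc, hfC]
  · rw [pull_comp, hψ', hdθ]
  · rw [pull_comp, ← hte, ← push_pull, ← push_pull, ← hθ, ← push_pull, hψθ, ← push_comp, hβ₁t]

end

end IsExtriangulated

end

end Extri

theorem proposition7p8 {C : Type u} [Category.{v} C] [Preadditive C] [HasZeroObject C] [HasBinaryBiproducts C]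
    (E : Cᵒᵖ ⥤ C ⥤ AddCommGrpCat.{w}) (s : Extri.Assignment E)
    (hC : Extri.IsExtriangulated E s) :
    (∀ {A₁ A₂ A₃ B₁ B₂ B₃ C₂ C₃ : C}
      (fA : A₁ ⟶ A₂) (gA : A₂ ⟶ A₃) (δA : Extri.Extn E A₃ A₁)
      (fB : B₁ ⟶ B₂) (gB : B₂ ⟶ B₃) (δB : Extri.Extn E B₃ B₁)
      (i₂ : A₂ ⟶ B₂) (p₂ : B₂ ⟶ C₂) (ε₂ : Extri.Extn E C₂ A₂)
      (i₃ : A₃ ⟶ B₃) (p₃ : B₃ ⟶ C₃) (ε₃ : Extri.Extn E C₃ A₃),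
      Extri.IsTriangle s fA gA δA → Extri.IsTriangle s fB gB δB →
      Extri.IsTriangle s i₂ p₂ ε₂ → Extri.IsTriangle s i₃ p₃ ε₃ →
      i₂ ≫ gB = gA ≫ i₃ →
      ∃ (i₁ : A₁ ⟶ B₁) (gC : C₂ ⟶ C₃),
        Extri.IsRetractOfInflation s i₁ ∧
        Extri.IsRetractOfDeflation s gC ∧
        Extri.IsHomotopic s fA gA δA fB gB δB i₁ i₂ i₃ ∧
        Extri.IsHomotopic s i₂ p₂ ε₂ i₃ p₃ ε₃ gA gB gC) ∧
    ((∀ {A₁ A₂ A₃ B₁ B₂ B₃ C₂ C₃ : C}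
      (fA : A₁ ⟶ A₂) (gA : A₂ ⟶ A₃) (δA : Extri.Extn E A₃ A₁)
      (fB : B₁ ⟶ B₂) (gB : B₂ ⟶ B₃) (δB : Extri.Extn E B₃ B₁)
      (i₂ : A₂ ⟶ B₂) (p₂ : B₂ ⟶ C₂) (ε₂ : Extri.Extn E C₂ A₂)
      (i₃ : A₃ ⟶ B₃) (p₃ : B₃ ⟶ C₃) (ε₃ : Extri.Extn E C₃ A₃),
      Extri.IsTriangle s fA gA δA → Extri.IsTriangle s fB gB δB →
      Extri.IsTriangle s i₂ p₂ ε₂ → Extri.IsTriangle s i₃ p₃ ε₃ →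
      i₂ ≫ gB = gA ≫ i₃ →
      ∃ (C₁ : C) (i₁ : A₁ ⟶ B₁) (p₁ : B₁ ⟶ C₁) (ε₁ : Extri.Extn E C₁ A₁)
        (fC : C₁ ⟶ C₂) (gC : C₂ ⟶ C₃) (δC : Extri.Extn E C₃ C₁),
        Extri.IsThreeByThree s fA gA δA fB gB δB fC gC δC i₁ p₁ ε₁ i₂ p₂ ε₂ i₃ p₃ ε₃) ↔
      Extri.WeaklyIdempotentComplete C) := by
  refine ⟨?_, ?_, ?_⟩
  · intro A₁ A₂ A₃ B₁ B₂ B₃ C₂ C₃ fA gA δA fB gB δB i₂ p₂ ε₂ i₃ p₃ ε₃ hA hB h₂ h₃ hi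
    obtain ⟨i₁, h⟩ := hC.exists_homotopic_left hA hB i₂ i₃ hi
    obtain ⟨gC, h'⟩ := hC.exists_homotopic_right h₂ h₃ gA gB hi
    refine ⟨i₁, gC, hC.isRetractOfInflation_of_comp (g := fB) ?_,
      hC.isRetractOfDeflation_of_comp (f := p₂) ?_, h, h'⟩
    · rw [← h.2.2.1.comm_left]
      exact hC.isInflation_comp ⟨_, _, _, hA⟩ ⟨_, _, _, h₂⟩
    · rw [h'.2.2.1.comm_right]
      exact hC.isDeflation_comp ⟨_, _, _, hB⟩ ⟨_, _, _, h₃⟩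
  · intro H A B f hf
    have hfr : f ≫ retraction f = 𝟙 A := IsSplitMono.id f
    -- The first component of `fB` is the identity and that of `i₂` is `f`, while `fA` is an
    -- identity; the left square therefore forces `i₁ = f`.
    have hB : Extri.IsTriangle s (biprod.lift (𝟙 B) (retraction f))
        (biprod.desc (-retraction f) (𝟙 A)) (0 : Extri.Extn E A B) :=
      hC.isTriangle_of_splitting _ _ biprod.fst biprod.inr (by simp) (by simp)
        (by ext <;> simp) (by simp) (by simp)
    have h₂ : Extri.IsTriangle s (biprod.lift f (𝟙 A))
        (biprod.desc (𝟙 B) (-f)) (0 : Extri.Extn E B A) :=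
      hC.isTriangle_of_splitting _ _ biprod.snd biprod.inl (by simp) (by simp)
        (by ext <;> simp) (by simp) (by simp)
    obtain ⟨C₁, i₁, p₁, ε₁, _, _, _, h⟩ := H _ _ _ _ _ _ _ _ _ _ _ _
      (hC.isTriangle_id_left A) hB h₂ (hC.isTriangle_id_right A) (by simp [hfr])
    have hi₁ : i₁ = f := by
      have := congrArg (fun x => x ≫ biprod.fst) h.mor_i.comm_left
      simpa using this.symm
    exact hC.hasCokernel_of_isInflation f ⟨_, _, _, hi₁ ▸ h.col₁⟩
  · intro hw A₁ A₂ A₃ B₁ B₂ B₃ C₂ C₃ fA gA δA fB gB δB i₂ p₂ ε₂ i₃ p₃ ε₃ hA hB h₂ h₃ hi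
    obtain ⟨i₁, h⟩ := hC.exists_homotopic_left hA hB i₂ i₃ hi
    have hi₁ : Extri.IsInflation s i₁ := hC.isInflation_of_comp hw (g := fB) (by
      rw [← h.2.2.1.comm_left]
      exact hC.isInflation_comp ⟨_, _, _, hA⟩ ⟨_, _, _, h₂⟩)
    obtain ⟨C₁, p₁, ε₁, fC, gC, δC, h'⟩ := hC.exists_threeByThree h hi₁ h₂ h₃
    exact ⟨C₁, i₁, p₁, ε₁, fC, gC, δC, h'⟩
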